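/- Let $\nu$ be a non-zero measure on a measurable space $\mathcal Y$, $T:\mathcal Y\to\mathbb R^p$ measurable, $\Theta=\{\theta\in\mathbb R^p:\int e^{\theta\cdot T}\,d\nu<\infty\}$ and $A(\theta)=\log\int e^{\theta\cdot T}\,d\nu$. Let $\{p_\theta:\theta\in\Theta\}$, with $\log p_\theta(y)=\ell_\theta(y)=\theta\cdot T(y)-A(\theta)$ (densities with respect to $\nu$), be a regular exponential family: $\Theta$ is open and non-empty, and $a\cdot T$ is $\nu$-a.e. constant only for $a=0$. Let $\mathcal M$ be a countable set of submodels, each given by its parameter set $\Theta^M\subset\Theta$. Let $y_1,y_2,\dots$ be i.i.d. from a distribution $f^*$, which need not belong to the family, with $E_{f^*}\|T\|^2<\infty$; put $\bar T_n=n^{-1}\sum_{i\le n}T(y_i)$, and let $S_n:\mathbb R^p\to\mathcal M$ be measurable selection rules. Fix $M\in\mathcal M$, let $P_n(M)=P(S_n(\bar T_n)=M)$, and let $P_{n,\theta}(M)$ be the probability of $\{S_n(\bar T_n)=M\}$ when $y_1,\dots,y_n$ are i.i.d. from $p_\theta$. Let $\theta_0\in\Theta^M$ maximize $\theta\mapsto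 E_{f^*}[\ell_\theta(y)]$ over $\Theta^M$. A conditional MLE is a maximizer over $\theta\in\Theta^M$ of $$\frac1n\sum_{i=1}^n\ell_\theta(y_i)-\frac1n\log P_{n,\theta}(M).$$ Assume $P_n(M)^{-1}=o(n)$ and $\lim_{n\to\infty}\inf_{\theta\in\Theta^M}P_{n,\theta}(M)\,e^n=\infty$, and assume that for some ball $U\subset\Theta$ centred at $\theta_0$ at least one of the following holds: (a) $\Theta^M$ is star-shaped about $\theta_0$ (for instance convex), and $\sup_{\theta\in U\cap\Theta^M}P_{n,\theta}(M)^{-1}=o(n)$; (b) $E_{f^*}[T]=E_{\theta_0}[T]$ (for instance $f^*=p_{\theta_0}$), and $\sup_{\theta\in U}P_{n,\theta}(M)^{-1}=o(n)$. Then the conditional MLE is post-selection consistent for $\theta_0$: for every sequence $\hat\theta_n^M$ such that $P(\hat\theta^M_n\text{ is a conditional MLE}\mid S_n(\bar T_n)=M)\to1$, $$\lim_{n\to\infty}P\bigl(\|\hat\theta_n^M-\theta_0\|_\infty>\varepsilon\mid S_n(\bar T_n)=M\bigr)=0\qquad\text{for every }\varepsilon>0.$$ Moreover, if $\Theta^M$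 is relatively closed in $\Theta$, then the conditional probability given $S_n(\bar T_n)=M$ that a conditional MLE exists tends to $1$. -/

import Mathlib

open MeasureTheory ProbabilityTheory Filter Topology Set

namespace SelectiveMLE

noncomputable section

/-- The natural parameter space of the exponential family with base measure `ν` and sufficient
statistic `T`. (A carrier density `h` is absorbed into `ν`.) -/
def naturalParams {Y : Type*} [MeasurableSpace Y] {p : ℕ} (ν : Measure Y) (T : Y → Fin p → ℝ) :
    Set (Fin p → ℝ) :=
  {θ | Integrable (fun y => Real.exp (θ ⬝ᵥ T y)) ν}

/-- Regular exponential family: the natural parameter space is open and non-empty, and the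
representation is minimal, i.e. the coordinates of `T` are affinely independent. -/
structure IsRegularExpFamily {Y : Type*} [MeasurableSpace Y] {p : ℕ}
    (ν : Measure Y) (T : Y → Fin p → ℝ) : Prop where
  base_ne_zero : ν ≠ 0
  measurable_stat : Measurable T
  isOpen_params : IsOpen (naturalParams ν T)
  nonempty_params : (naturalParams ν T).Nonempty
  minimal : ∀ (a : Fin p → ℝ) (c : ℝ), (∀ᵐ y ∂ν, a ⬝ᵥ T y = c) → a = 0

/-- The log-partition function `A(θ) = log ∫ exp(θ · T) dν`. -/
def logPartition {Y : Type*} [MeasurableSpace Y] {p : ℕ} (ν : Measure Y) (T : Y → Fin p → ℝ)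
    (θ : Fin p → ℝ) : ℝ :=
  Real.log (∫ y, Real.exp (θ ⬝ᵥ T y) ∂ν)

/-- The log-likelihood `ℓ_θ(y) = log p_θ(y) = θ · T(y) - A(θ)` of one observation, where `p_θ` is
the density with respect to `ν`. -/
def logLik {Y : Type*} [MeasurableSpace Y] {p : ℕ} (ν : Measure Y) (T : Y → Fin p → ℝ)
    (θ : Fin p → ℝ) (y : Y) : ℝ :=
  θ ⬝ᵥ T y - logPartition ν T θ

/-- The member of the family with parameter `θ`: the measure with density `exp (ℓ_θ)`
with respect to `ν`. -/
def famMeasure {Y : Type*} [MeasurableSpace Y] {p : ℕ} (ν : Measure Y) (T : Y → Fin p → ℝ)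
    (θ : Fin p → ℝ) : Measure Y :=
  ν.withDensity fun y => ENNReal.ofReal (Real.exp (logLik ν T θ y))

/-- The average `T̄_n = n⁻¹ ∑ T(y_i)` of the sufficient statistic over a sample of size `n`. -/
def meanStat {Y : Type*} {p : ℕ} (T : Y → Fin p → ℝ) (n : ℕ) (y : Fin n → Y) : Fin p → ℝ :=
  (n : ℝ)⁻¹ • ∑ i, T (y i)

/-- The event that the submodel `M` is selected from the first `n` terms of the sequence `y`.
Submodels are given by their parameter sets, and `𝓜` is the collection of candidates. -/
def selEvent {Ω Y : Type*} {p : ℕ} {𝓜 : Set (Set (Fin p → ℝ))} (T : Y → Fin p → ℝ)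
    (S : ℕ → (Fin p → ℝ) → 𝓜) (M : 𝓜) (y : ℕ → Ω → Y) (n : ℕ) : Set Ω :=
  {ω | S n (meanStat T n fun i => y i ω) = M}

/-- The model-based selection probability `P_{n,θ}(M)`: the probability of selecting `M` when the
sample of size `n` is i.i.d. from the member of the family with parameter `θ`. -/
def modelSelProb {Y : Type*} [MeasurableSpace Y] {p : ℕ} {𝓜 : Set (Set (Fin p → ℝ))}
    (ν : Measure Y) (T : Y → Fin p → ℝ) (S : ℕ → (Fin p → ℝ) → 𝓜) (M : 𝓜) (n : ℕ)
    (θ : Fin p → ℝ) : ENNReal :=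
  Measure.pi (fun _ : Fin n => famMeasure ν T θ) {y | S n (meanStat T n y) = M}

/-- The normalized conditional log-likelihood
`n⁻¹ ∑ ℓ_θ(y_i) - n⁻¹ log P_{n,θ}(M)` of a sample of size `n`. -/
def condLogLik {Y : Type*} [MeasurableSpace Y] {p : ℕ} {𝓜 : Set (Set (Fin p → ℝ))}
    (ν : Measure Y) (T : Y → Fin p → ℝ) (S : ℕ → (Fin p → ℝ) → 𝓜) (M : 𝓜) (n : ℕ)
    (y : Fin n → Y) (θ : Fin p → ℝ) : ℝ :=
  (n : ℝ)⁻¹ * ∑ i, logLik ν T θ (y i) - (n : ℝ)⁻¹ * Real.log (modelSelProb ν T S M n θ).toReal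

/-- `θ` is a conditional maximum likelihood estimate for the selected model `M`: it maximizes the
conditional log-likelihood over the parameter set of `M`. -/
def IsCondMLE {Y : Type*} [MeasurableSpace Y] {p : ℕ} {𝓜 : Set (Set (Fin p → ℝ))}
    (ν : Measure Y) (T : Y → Fin p → ℝ) (S : ℕ → (Fin p → ℝ) → 𝓜) (M : 𝓜) (n : ℕ)
    (y : Fin n → Y) (θ : Fin p → ℝ) : Prop :=
  θ ∈ M.1 ∧ IsMaxOn (condLogLik ν T S M n y) M.1 θ

/-- `sup_{θ ∈ V} P_{n,θ}(M)⁻¹ = o(n)`, computed in `[0, ∞]`, where `0⁻¹ = ∞`. -/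
def InvSelProbSmallOn {Y : Type*} [MeasurableSpace Y] {p : ℕ} {𝓜 : Set (Set (Fin p → ℝ))}
    (ν : Measure Y) (T : Y → Fin p → ℝ) (S : ℕ → (Fin p → ℝ) → 𝓜) (M : 𝓜)
    (V : Set (Fin p → ℝ)) : Prop :=
  Tendsto (fun n : ℕ => (⨆ θ ∈ V, (modelSelProb ν T S M n θ)⁻¹) / (n : ENNReal)) atTop (𝓝 0)

end

end SelectiveMLE

/-! The conditional log-likelihood is itself concave. Since `P_{n,θ}(M)` is the integral of the
product density over the selection event, its logarithm is `A_{n,M}(θ) - n A(θ)`, where `A_{n,M}` is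
the log-partition function of the product measure restricted to that event. The terms in `A` cancel,
leaving `θ · T̄_n - n⁻¹ A_{n,M}(θ)`, a linear function minus a convex one
(`condLogLik_eq_sub_logPartition`, `concaveOn_condLogLik`).

Concavity turns a comparison on one small sphere around `θ₀` into a global one, so the penalty needs
control only near `θ₀`. Let `m = E_f[T]`. The expected log-likelihood `θ · m - A(θ)` is strictly
concave by minimality, hence lies below its maximum by a fixed gap `η` on the sphere
(`exists_gap_on_sphere`). There the penalty is at most `log n / n`, and replacing `m` by `T̄_n`
costs little once `T̄_n` is near `m` (`eventually_condLogLik_lt`).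

By Chebyshev, `T̄_n` is far from `m` with probability `O(1/n)`; dividing by `P_n(M)`, whose inverse
is `o(n)`, still gives a limit of zero (`tendsto_cond_deviation`). Off this event every maximizer is
near `θ₀`, and compactness of a ball gives existence. -/

namespace SelectiveMLE

/-! ### Convexity of the log-partition function of an arbitrary base measure -/

section LogPartition

variable {Z : Type*} [MeasurableSpace Z] {p : ℕ} {μ : Measure Z} {X : Z → Fin p → ℝ}

theorem convex_naturalParams (hX : Measurable X) : Convex ℝ (naturalParams μ X) := by
  intro θ hθ θ' hθ' a b ha hb hab
  refine Integrable.mono' ((hθ.const_mul a).add (hθ'.const_mul b)) ?_ ?_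
  · refine Measurable.aestronglyMeasurable (Real.measurable_exp.comp ?_)
    simp only [dotProduct]
    fun_prop
  · refine ae_of_all _ fun y => ?_
    have := convexOn_exp.2 (mem_univ (θ ⬝ᵥ X y)) (mem_univ (θ' ⬝ᵥ X y)) ha hb hab
    simpa [add_dotProduct, smul_dotProduct, Real.abs_exp] using this

theorem exp_logLik (θ : Fin p → ℝ) (y : Z) :
    Real.exp (logLik μ X θ y) =
      Real.exp (θ ⬝ᵥ X y) * Real.exp (-logPartition μ X θ) := by
  rw [logLik, sub_eq_add_neg, Real.exp_add]

theorem integrable_exp_logLik {θ : Fin p → ℝ} (hθ : θ ∈ naturalParams μ X) :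
    Integrable (fun y => Real.exp (logLik μ X θ y)) μ := by
  simp_rw [exp_logLik]
  exact hθ.mul_const _

theorem exp_logPartition (hμ : μ ≠ 0) {θ : Fin p → ℝ} (hθ : θ ∈ naturalParams μ X) :
    Real.exp (logPartition μ X θ) = ∫ y, Real.exp (θ ⬝ᵥ X y) ∂μ := by
  have : NeZero μ := ⟨hμ⟩
  exact Real.exp_log (integral_exp_pos hθ)

theorem integral_exp_logLik (hμ : μ ≠ 0) {θ : Fin p → ℝ} (hθ : θ ∈ naturalParams μ X) :
    ∫ y, Real.exp (logLik μ X θ y) ∂μ = 1 := by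
  simp_rw [exp_logLik]
  rw [integral_mul_const, ← exp_logPartition hμ hθ, ← Real.exp_add, add_neg_cancel,
    Real.exp_zero]

theorem exp_combo_logLik {θ θ' : Fin p → ℝ} (a b : ℝ) (y : Z) :
    Real.exp (a * logLik μ X θ y + b * logLik μ X θ' y) =
      Real.exp ((a • θ + b • θ') ⬝ᵥ X y) *
        Real.exp (-(a * logPartition μ X θ + b * logPartition μ X θ')) := by
  rw [← Real.exp_add]
  congr 1
  simp only [logLik, add_dotProduct, smul_dotProduct, smul_eq_mul]
  ring

theorem integrable_exp_combo_logLik (hX : Measurable X) {θ θ' : Fin p → ℝ}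
    (hθ : θ ∈ naturalParams μ X) (hθ' : θ' ∈ naturalParams μ X) {a b : ℝ}
    (ha : 0 ≤ a) (hb : 0 ≤ b) (hab : a + b = 1) :
    Integrable (fun y => Real.exp (a * logLik μ X θ y + b * logLik μ X θ' y)) μ := by
  simp_rw [exp_combo_logLik]
  exact (convex_naturalParams hX hθ hθ' ha hb hab : Integrable _ _).mul_const _

theorem integral_exp_combo_logLik (hμ : μ ≠ 0) (hX : Measurable X) {θ θ' : Fin p → ℝ}
    (hθ : θ ∈ naturalParams μ X) (hθ' : θ' ∈ naturalParams μ X) {a b : ℝ}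
    (ha : 0 ≤ a) (hb : 0 ≤ b) (hab : a + b = 1) :
    ∫ y, Real.exp (a * logLik μ X θ y + b * logLik μ X θ' y) ∂μ =
      Real.exp (logPartition μ X (a • θ + b • θ') -
        (a * logPartition μ X θ + b * logPartition μ X θ')) := by
  simp_rw [exp_combo_logLik]
  rw [integral_mul_const,
    ← exp_logPartition hμ (convex_naturalParams hX hθ hθ' ha hb hab), ← Real.exp_add,
    ← sub_eq_add_neg]

theorem integral_combo_exp_logLik (hμ : μ ≠ 0) {θ θ' : Fin p → ℝ}
    (hθ : θ ∈ naturalParams μ X) (hθ' : θ' ∈ naturalParams μ X) {a b : ℝ} (hab : a + b = 1) :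
    ∫ y, (a * Real.exp (logLik μ X θ y) + b * Real.exp (logLik μ X θ' y)) ∂μ = 1 := by
  rw [integral_add ((integrable_exp_logLik hθ).const_mul a)
    ((integrable_exp_logLik hθ').const_mul b), integral_const_mul, integral_const_mul,
    integral_exp_logLik hμ hθ, integral_exp_logLik hμ hθ', mul_one, mul_one, hab]

/-- Weighted AM-GM for densities, `p_θ^a p_θ'^b ≤ a p_θ + b p_θ'`, integrates to `exp (A(aθ + bθ') -
a A(θ) - b A(θ')) ≤ 1`. The base measure is kept general because the result is also applied to the
product measure restricted to the selection event. -/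
theorem convexOn_logPartition (hμ : μ ≠ 0) (hX : Measurable X) :
    ConvexOn ℝ (naturalParams μ X) (logPartition μ X) := by
  refine ⟨convex_naturalParams hX, fun θ hθ θ' hθ' a b ha hb hab => ?_⟩
  have h := integral_mono (integrable_exp_combo_logLik hX hθ hθ' ha hb hab)
    (((integrable_exp_logLik hθ).const_mul a).add ((integrable_exp_logLik hθ').const_mul b))
    (fun y => convexOn_exp.2 (mem_univ (logLik μ X θ y)) (mem_univ (logLik μ X θ' y)) ha hb hab)
  have h1 := integral_combo_exp_logLik hμ hθ hθ' hab
  simp only [Pi.add_apply] at h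
  rw [h1, integral_exp_combo_logLik hμ hX hθ hθ' ha hb hab, Real.exp_le_one_iff] at h
  simp only [smul_eq_mul]
  linarith

end LogPartition

/-! ### Consequences of regularity: strict convexity, normalization, σ-finiteness -/

section RegularFamily

variable {Y : Type*} [MeasurableSpace Y] {p : ℕ} {ν : Measure Y} {T : Y → Fin p → ℝ}

/-- Equality would make the two sides of the AM-GM inequality have equal integrals, hence agree a.e.
Strict convexity of `exp` then forces `ℓ_θ = ℓ_θ'` a.e., so `(θ - θ') · T` is a.e. constant, against
minimality. -/
theorem IsRegularExpFamily.strictConvexOn_logPartition (h : IsRegularExpFamily ν T) :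
    StrictConvexOn ℝ (naturalParams ν T) (logPartition ν T) := by
  have hX := h.measurable_stat
  refine ⟨convex_naturalParams hX, fun θ hθ θ' hθ' hne a b ha hb hab => ?_⟩
  refine lt_of_le_of_ne ((convexOn_logPartition h.base_ne_zero hX).2 hθ hθ' ha.le hb.le hab) ?_
  intro heq
  simp only [smul_eq_mul] at heq
  have hi := integrable_exp_combo_logLik hX hθ hθ' ha.le hb.le hab
  have hj := ((integrable_exp_logLik hθ).const_mul a).add ((integrable_exp_logLik hθ').const_mul b)
  have hle : ∀ y, Real.exp (a * logLik ν T θ y + b * logLik ν T θ' y) ≤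
      a * Real.exp (logLik ν T θ y) + b * Real.exp (logLik ν T θ' y) := fun y =>
    convexOn_exp.2 (mem_univ (logLik ν T θ y)) (mem_univ (logLik ν T θ' y)) ha.le hb.le hab
  have hint := integral_exp_combo_logLik h.base_ne_zero hX hθ hθ' ha.le hb.le hab
  rw [heq, sub_self, Real.exp_zero,
    ← integral_combo_exp_logLik h.base_ne_zero hθ hθ' hab] at hint
  have hae := (integral_eq_iff_of_ae_le hi hj (ae_of_all _ hle)).1 hint
  refine hne (sub_eq_zero.1 (h.minimal _ (logPartition ν T θ - logPartition ν T θ') ?_))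
  filter_upwards [hae] with y hy
  by_contra hcon
  have hlt := strictConvexOn_exp.2 (mem_univ (logLik ν T θ y)) (mem_univ (logLik ν T θ' y))
    (fun hll => hcon (by simp only [logLik] at hll; rw [sub_dotProduct]; linarith)) ha hb hab
  simp only [smul_eq_mul] at hlt
  exact hlt.ne hy

theorem IsRegularExpFamily.continuousOn_logPartition (h : IsRegularExpFamily ν T) :
    ContinuousOn (logPartition ν T) (naturalParams ν T) :=
  (convexOn_logPartition h.base_ne_zero h.measurable_stat).continuousOn h.isOpen_params

theorem measurable_logLik (hT : Measurable T) (θ : Fin p → ℝ) : Measurable (logLik ν T θ) := by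
  unfold logLik dotProduct
  fun_prop

theorem IsRegularExpFamily.isProbabilityMeasure_famMeasure (h : IsRegularExpFamily ν T)
    {θ : Fin p → ℝ} (hθ : θ ∈ naturalParams ν T) : IsProbabilityMeasure (famMeasure ν T θ) := by
  constructor
  rw [famMeasure, withDensity_apply _ MeasurableSet.univ, Measure.restrict_univ,
    ← ofReal_integral_eq_lintegral_ofReal (integrable_exp_logLik hθ)
      (ae_of_all _ fun y => (Real.exp_pos _).le),
    integral_exp_logLik h.base_ne_zero hθ, ENNReal.ofReal_one]

/-- `ν` is recovered from a probability measure of the family by the reciprocal density, which is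
finite everywhere. Product measures of `ν` depend on this. -/
theorem IsRegularExpFamily.sigmaFinite (h : IsRegularExpFamily ν T) : SigmaFinite ν := by
  obtain ⟨θ, hθ⟩ := h.nonempty_params
  have := h.isProbabilityMeasure_famMeasure hθ
  have hm : Measurable fun y => ENNReal.ofReal (Real.exp (logLik ν T θ y)) :=
    (Real.measurable_exp.comp (measurable_logLik h.measurable_stat θ)).ennreal_ofReal
  have hinv := withDensity_inv_same (μ := ν) hm (ae_of_all _ fun y => by simp [Real.exp_pos])
    (ae_of_all _ fun y => ENNReal.ofReal_ne_top)
  have hsf : SigmaFinite ((famMeasure ν T θ).withDensity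
      fun y => (ENNReal.ofReal (Real.exp (logLik ν T θ y)))⁻¹) :=
    SigmaFinite.withDensity_of_ne_top (ae_of_all _ fun y => by simp [Real.exp_pos])
  rwa [famMeasure, hinv] at hsf

end RegularFamily

/-! ### The i.i.d. sample as an exponential family in `∑ T(y_i)` -/

section ProductFamily

variable {Y : Type*} [MeasurableSpace Y] {p : ℕ} {ν : Measure Y} {T : Y → Fin p → ℝ}

theorem pi_withDensity_ofReal {ι : Type*} [Fintype ι] [SigmaFinite ν] {g : Y → ℝ}
    (hg : ∀ y, 0 ≤ g y) (hgi : Integrable g ν) :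
    Measure.pi (fun _ : ι => ν.withDensity fun y => ENNReal.ofReal (g y)) =
      (Measure.pi fun _ : ι => ν).withDensity fun y => ENNReal.ofReal (∏ i, g (y i)) := by
  have : SigmaFinite (ν.withDensity fun y => ENNReal.ofReal (g y)) :=
    SigmaFinite.withDensity_of_ne_top (ae_of_all _ fun y => ENNReal.ofReal_ne_top)
  refine Measure.pi_eq fun s hs => ?_
  have hp : Integrable (fun y : ι → Y => ∏ i, g (y i)) (Measure.pi fun i => ν.restrict (s i)) :=
    Integrable.fintype_prod fun i => hgi.restrict
  rw [withDensity_apply _ (MeasurableSet.univ_pi hs), Measure.restrict_pi_pi,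
    ← ofReal_integral_eq_lintegral_ofReal hp
      (ae_of_all _ fun y => Finset.prod_nonneg fun i _ => hg _),
    integral_fintype_prod_eq_prod (fun _ => g),
    ENNReal.ofReal_prod_of_nonneg fun i _ => integral_nonneg hg]
  refine Finset.prod_congr rfl fun i _ => ?_
  rw [withDensity_apply _ (hs i),
    ofReal_integral_eq_lintegral_ofReal hgi.restrict (ae_of_all _ hg)]

theorem sum_logLik {ι : Type*} [Fintype ι] (θ : Fin p → ℝ) (y : ι → Y) :
    ∑ i, logLik ν T θ (y i) =
      θ ⬝ᵥ (∑ i, T (y i)) - Fintype.card ι * logPartition ν T θ := by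
  simp [logLik, Finset.sum_sub_distrib, dotProduct_sum]

theorem measurable_sum_stat (hT : Measurable T) {ι : Type*} [Fintype ι] :
    Measurable fun y : ι → Y => ∑ i, T (y i) := by
  fun_prop

theorem measurable_meanStat (hT : Measurable T) (n : ℕ) : Measurable (meanStat T n) := by
  unfold meanStat
  fun_prop

theorem integrable_prod_exp_logLik [SigmaFinite ν] {ι : Type*} [Fintype ι] {θ : Fin p → ℝ}
    (hθ : θ ∈ naturalParams ν T) :
    Integrable (fun y : ι → Y => ∏ i, Real.exp (logLik ν T θ (y i)))
      (Measure.pi fun _ : ι => ν) :=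
  Integrable.fintype_prod fun _ => integrable_exp_logLik hθ

theorem prod_exp_logLik {ι : Type*} [Fintype ι] (θ : Fin p → ℝ) (y : ι → Y) :
    ∏ i, Real.exp (logLik ν T θ (y i)) =
      Real.exp (θ ⬝ᵥ (∑ i, T (y i))) *
        Real.exp (-(Fintype.card ι * logPartition ν T θ)) := by
  rw [← Real.exp_sum, sum_logLik, sub_eq_add_neg, Real.exp_add]

theorem naturalParams_subset_pi [SigmaFinite ν] {ι : Type*} [Fintype ι] (E : Set (ι → Y)) :
    naturalParams ν T ⊆
      naturalParams ((Measure.pi fun _ : ι => ν).restrict E) fun y => ∑ i, T (y i) := by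
  intro θ hθ
  have h := ((integrable_prod_exp_logLik (ι := ι) hθ).restrict (s := E)).mul_const
    (Real.exp (Fintype.card ι * logPartition ν T θ))
  refine h.congr (ae_of_all _ fun y => ?_)
  dsimp only
  rw [prod_exp_logLik, mul_assoc, ← Real.exp_add, neg_add_cancel, Real.exp_zero, mul_one]

theorem pi_famMeasure_apply [SigmaFinite ν] {ι : Type*} [Fintype ι] {θ : Fin p → ℝ}
    (hθ : θ ∈ naturalParams ν T) {E : Set (ι → Y)} (hE : MeasurableSet E) :
    Measure.pi (fun _ : ι => famMeasure ν T θ) E =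
      ENNReal.ofReal ((∫ y in E, Real.exp (θ ⬝ᵥ (∑ i, T (y i))) ∂(Measure.pi fun _ : ι => ν)) *
        Real.exp (-(Fintype.card ι * logPartition ν T θ))) := by
  simp only [famMeasure]
  rw [pi_withDensity_ofReal (fun y => (Real.exp_pos _).le) (integrable_exp_logLik hθ),
    withDensity_apply _ hE, ← ofReal_integral_eq_lintegral_ofReal
      (integrable_prod_exp_logLik hθ).restrict
      (ae_of_all _ fun y => Finset.prod_nonneg fun i _ => (Real.exp_pos _).le)]
  simp_rw [prod_exp_logLik]
  rw [integral_mul_const]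

/-- The log-probability of an event under an i.i.d. sample is, up to the cumulant term, the
log-partition function of the family generated by the restricted product measure. -/
theorem log_pi_famMeasure [SigmaFinite ν] {ι : Type*} [Fintype ι] {θ : Fin p → ℝ}
    (hθ : θ ∈ naturalParams ν T) {E : Set (ι → Y)} (hE : MeasurableSet E)
    (hne : (Measure.pi fun _ : ι => ν).restrict E ≠ 0) :
    Real.log (Measure.pi (fun _ : ι => famMeasure ν T θ) E).toReal =
      logPartition ((Measure.pi fun _ : ι => ν).restrict E) (fun y => ∑ i, T (y i)) θ -
        Fintype.card ι * logPartition ν T θ := by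
  have : NeZero ((Measure.pi fun _ : ι => ν).restrict E) := ⟨hne⟩
  have hpos := integral_exp_pos (naturalParams_subset_pi E hθ)
  rw [pi_famMeasure_apply hθ hE, ENNReal.toReal_ofReal
    (mul_nonneg hpos.le (Real.exp_pos _).le), Real.log_mul hpos.ne' (Real.exp_pos _).ne',
    Real.log_exp, ← sub_eq_add_neg]
  rfl

end ProductFamily

/-! ### Concavity of the conditional log-likelihood -/

section Selection

variable {Y : Type*} [MeasurableSpace Y] {p : ℕ} {ν : Measure Y} {T : Y → Fin p → ℝ}
  {𝓜 : Set (Set (Fin p → ℝ))} {S : ℕ → (Fin p → ℝ) → 𝓜} {M : 𝓜}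

theorem measurableSet_selected (hT : Measurable T) (hS : ∀ n N, MeasurableSet {t | S n t = N})
    (n : ℕ) : MeasurableSet {y : Fin n → Y | S n (meanStat T n y) = M} :=
  measurable_meanStat hT n (hS n M)

theorem condLogLik_eq_sub_log {n : ℕ} (hn : n ≠ 0) (y : Fin n → Y) (θ : Fin p → ℝ) :
    condLogLik ν T S M n y θ = θ ⬝ᵥ meanStat T n y - logPartition ν T θ -
      (n : ℝ)⁻¹ * Real.log (modelSelProb ν T S M n θ).toReal := by
  have : (n : ℝ) ≠ 0 := Nat.cast_ne_zero.2 hn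
  rw [condLogLik, sum_logLik, meanStat, dotProduct_smul, Fintype.card_fin, smul_eq_mul]
  field_simp

theorem IsRegularExpFamily.restrict_ne_zero (h : IsRegularExpFamily ν T)
    (hS : ∀ n N, MeasurableSet {t | S n t = N}) {n : ℕ} {θ : Fin p → ℝ}
    (hθ : θ ∈ naturalParams ν T) (hpos : modelSelProb ν T S M n θ ≠ 0) :
    (Measure.pi fun _ : Fin n => ν).restrict {y | S n (meanStat T n y) = M} ≠ 0 := by
  have := h.sigmaFinite
  intro h0
  apply hpos
  rw [modelSelProb, pi_famMeasure_apply hθ (measurableSet_selected h.measurable_stat hS n), h0]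
  simp

/-- The term `-A(θ)` of the likelihood cancels against the one in `-n⁻¹ log P_{n,θ}(M)`. A single
`θ₁` with positive selection probability suffices to make the restricted product measure non-zero,
and so to give the formula at every `θ`. -/
theorem IsRegularExpFamily.condLogLik_eq_sub_logPartition (h : IsRegularExpFamily ν T)
    (hS : ∀ n N, MeasurableSet {t | S n t = N}) {n : ℕ} (hn : n ≠ 0) {θ₁ θ : Fin p → ℝ}
    (hθ₁ : θ₁ ∈ naturalParams ν T) (hpos : modelSelProb ν T S M n θ₁ ≠ 0)
    (hθ : θ ∈ naturalParams ν T) (y : Fin n → Y) :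
    condLogLik ν T S M n y θ = θ ⬝ᵥ meanStat T n y - (n : ℝ)⁻¹ *
      logPartition ((Measure.pi fun _ : Fin n => ν).restrict {y | S n (meanStat T n y) = M})
        (fun y => ∑ i, T (y i)) θ := by
  have := h.sigmaFinite
  have hn' : (n : ℝ) ≠ 0 := Nat.cast_ne_zero.2 hn
  rw [condLogLik_eq_sub_log hn, modelSelProb,
    log_pi_famMeasure hθ (measurableSet_selected h.measurable_stat hS n)
      (h.restrict_ne_zero hS hθ₁ hpos), Fintype.card_fin]
  field_simp
  ring

theorem IsRegularExpFamily.concaveOn_condLogLik (h : IsRegularExpFamily ν T)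
    (hS : ∀ n N, MeasurableSet {t | S n t = N}) {n : ℕ} (hn : n ≠ 0) {θ₁ : Fin p → ℝ}
    (hθ₁ : θ₁ ∈ naturalParams ν T) (hpos : modelSelProb ν T S M n θ₁ ≠ 0) (y : Fin n → Y) :
    ConcaveOn ℝ (naturalParams ν T) (condLogLik ν T S M n y) := by
  have := h.sigmaFinite
  have hA := (convexOn_logPartition (h.restrict_ne_zero hS hθ₁ hpos)
    (measurable_sum_stat h.measurable_stat)).subset
      (naturalParams_subset_pi _) (convex_naturalParams (μ := ν) h.measurable_stat)
  refine ⟨convex_naturalParams h.measurable_stat, fun θ hθ θ' hθ' a b ha hb hab => ?_⟩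
  have hle := mul_le_mul_of_nonneg_left (hA.2 hθ hθ' ha hb hab)
    (inv_nonneg.2 (Nat.cast_nonneg (α := ℝ) n))
  rw [h.condLogLik_eq_sub_logPartition hS hn hθ₁ hpos hθ,
    h.condLogLik_eq_sub_logPartition hS hn hθ₁ hpos hθ',
    h.condLogLik_eq_sub_logPartition hS hn hθ₁ hpos (hA.1 hθ hθ' ha hb hab)]
  simp only [smul_eq_mul, add_dotProduct, smul_dotProduct] at hle ⊢
  linarith

theorem IsRegularExpFamily.continuousOn_condLogLik (h : IsRegularExpFamily ν T)
    (hS : ∀ n N, MeasurableSet {t | S n t = N}) {n : ℕ} (hn : n ≠ 0) {θ₁ : Fin p → ℝ}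
    (hθ₁ : θ₁ ∈ naturalParams ν T) (hpos : modelSelProb ν T S M n θ₁ ≠ 0) (y : Fin n → Y) :
    ContinuousOn (condLogLik ν T S M n y) (naturalParams ν T) :=
  (h.concaveOn_condLogLik hS hn hθ₁ hpos y).continuousOn h.isOpen_params

end Selection

/-! ### Concave maximization over star-shaped sets -/

section ConcaveMaximization

variable {V : Type*} [NormedAddCommGroup V] [NormedSpace ℝ V] {D K : Set V} {x₀ : V}

/-- A concave function that is below its value at `x₀` on a sphere stays below it outside. -/
theorem lt_of_concaveOn_of_sphere {G : V → ℝ} (hG : ConcaveOn ℝ D G) (hKD : K ⊆ D)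
    (hx₀ : x₀ ∈ K) (hK : StarConvex ℝ x₀ K) {ε : ℝ} (hε : 0 < ε)
    (hsphere : ∀ x ∈ K, ‖x - x₀‖ = ε → G x < G x₀) {x : V} (hx : x ∈ K) (hxε : ε ≤ ‖x - x₀‖) :
    G x < G x₀ := by
  have hpos : 0 < ‖x - x₀‖ := hε.trans_le hxε
  -- This `t` places the point of the segment from `x₀` to `x` on the sphere of radius `ε`; if `G x
  -- ≥ G x₀`, concavity would give `G ≥ G x₀` there too.
  set t : ℝ := ε / ‖x - x₀‖ with ht
  have ht0 : 0 < t := div_pos hε hpos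
  have ht1 : t ≤ 1 := (div_le_one hpos).2 hxε
  have hmem : (1 - t) • x₀ + t • x ∈ K := hK hx (sub_nonneg.2 ht1) ht0.le (by ring)
  have hnorm : ‖(1 - t) • x₀ + t • x - x₀‖ = ε := by
    have : (1 - t) • x₀ + t • x - x₀ = t • (x - x₀) := by module
    rw [this, norm_smul, Real.norm_of_nonneg ht0.le, ht, div_mul_cancel₀ _ hpos.ne']
  have hlt := hsphere _ hmem hnorm
  have hle := hG.2 (hKD hx₀) (hKD hx) (sub_nonneg.2 ht1) ht0.le (by ring)
  simp only [smul_eq_mul] at hle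
  by_contra! hcon
  nlinarith

/-- A maximizer of a strictly concave function over a star-shaped set is well separated. -/
theorem exists_gap_on_sphere [ProperSpace V] {L : V → ℝ} (hD : IsOpen D)
    (hL : StrictConcaveOn ℝ D L) (hLc : ContinuousOn L D) (hKD : K ⊆ D)
    (hx₀ : x₀ ∈ K) (hK : StarConvex ℝ x₀ K) (hmax : IsMaxOn L K x₀) {ε : ℝ} (hε : 0 < ε)
    (hball : Metric.closedBall x₀ ε ⊆ D) :
    ∃ η > 0, ∀ x ∈ K, ‖x - x₀‖ = ε → L x ≤ L x₀ - η := by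
  -- `K` need not be closed, so maximality is first extended by continuity to its closure within
  -- `D`, whose trace on the sphere is compact.
  have hcl : ∀ x ∈ closure K, x ∈ D → L x ≤ L x₀ := fun x hx hxD => by
    have hne : (𝓝[K] x).NeBot := mem_closure_iff_nhdsWithin_neBot.1 hx
    exact le_of_tendsto (((hLc x hxD).continuousAt (hD.mem_nhds hxD)).tendsto.mono_left
      nhdsWithin_le_nhds) (eventually_nhdsWithin_of_forall fun z hz => hmax hz)
  have hsub : closure K ∩ Metric.sphere x₀ ε ⊆ D := fun x hx =>
    hball (Metric.sphere_subset_closedBall hx.2)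
  have hcomp : IsCompact (closure K ∩ Metric.sphere x₀ ε) :=
    (isCompact_sphere x₀ ε).inter_left isClosed_closure
  rcases (closure K ∩ Metric.sphere x₀ ε).eq_empty_or_nonempty with he | hne
  · refine ⟨1, one_pos, fun x hx hxε => ?_⟩
    have : x ∈ closure K ∩ Metric.sphere x₀ ε :=
      ⟨subset_closure hx, by rwa [mem_sphere_iff_norm]⟩
    rw [he] at this
    exact this.elim
  obtain ⟨x₁, hx₁, hx₁max⟩ := hcomp.exists_isMaxOn hne (hLc.mono hsub)
  have hne' : x₀ ≠ x₁ := by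
    rintro rfl
    have := mem_sphere_iff_norm.1 hx₁.2
    simp at this
    exact hε.ne this
  have hgap : L x₁ < L x₀ := by
    -- If the values at `x₀` and `x₁` were equal, strict concavity would make the midpoint larger;
    -- but star-shapedness puts the midpoint in `closure K`.
    refine lt_of_le_of_ne (hcl x₁ hx₁.1 (hsub hx₁)) fun heq => ?_
    have hmid := hL.2 (hKD hx₀) (hsub hx₁) hne' (one_half_pos (α := ℝ)) one_half_pos
      (add_halves 1)
    have hle := hcl _ (map_mem_closure (f := fun x => (1 / 2 : ℝ) • x₀ + (1 / 2 : ℝ) • x)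
      (by fun_prop) hx₁.1 fun x hx => hK hx one_half_pos.le one_half_pos.le (add_halves 1)) (hL.1 (hKD hx₀) (hsub hx₁) (one_half_pos (α := ℝ)).le
        one_half_pos.le (add_halves 1))
    simp only [smul_eq_mul] at hmid
    linarith
  refine ⟨L x₀ - L x₁, sub_pos.2 hgap, fun x hx hxε => ?_⟩
  have : L x ≤ L x₁ := hx₁max ⟨subset_closure hx, by rwa [mem_sphere_iff_norm]⟩
  linarith

end ConcaveMaximization

/-! ### Expected log-likelihood and moments of the statistic -/

section ExpectedLogLik

variable {Y : Type*} [MeasurableSpace Y] {p : ℕ} {ν : Measure Y} {T : Y → Fin p → ℝ}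

theorem integrable_dotProduct {f : Measure Y} (hT : Integrable T f) (θ : Fin p → ℝ) :
    Integrable (fun y => θ ⬝ᵥ T y) f :=
  integrable_finsetSum _ fun i _ => (hT.eval i).const_mul (θ i)

theorem integral_dotProduct {f : Measure Y} (hT : Integrable T f) (θ : Fin p → ℝ) :
    ∫ y, θ ⬝ᵥ T y ∂f = θ ⬝ᵥ ∫ y, T y ∂f := by
  simp only [dotProduct]
  rw [integral_finsetSum _ fun i _ => (hT.eval i).const_mul (θ i)]
  refine Finset.sum_congr rfl fun i _ => ?_
  rw [integral_const_mul, eval_integral fun i => hT.eval i]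

theorem integral_logLik {f : Measure Y} [IsProbabilityMeasure f] (hT : Integrable T f)
    (θ : Fin p → ℝ) :
    ∫ y, logLik ν T θ y ∂f = θ ⬝ᵥ (∫ y, T y ∂f) - logPartition ν T θ := by
  simp only [logLik]
  rw [integral_sub (integrable_dotProduct hT θ) (integrable_const _), integral_dotProduct hT,
    integral_const]
  simp

theorem IsRegularExpFamily.integrable_famMeasure_iff (h : IsRegularExpFamily ν T)
    (θ : Fin p → ℝ) (g : Y → ℝ) :
    Integrable g (famMeasure ν T θ) ↔
      Integrable (fun y => Real.exp (logLik ν T θ y) * g y) ν := by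
  have hm : Measurable fun y => ENNReal.ofReal (Real.exp (logLik ν T θ y)) :=
    (Real.measurable_exp.comp (measurable_logLik h.measurable_stat θ)).ennreal_ofReal
  rw [famMeasure, integrable_withDensity_iff_integrable_smul' hm
    (ae_of_all _ fun y => ENNReal.ofReal_lt_top)]
  simp [ENNReal.toReal_ofReal, (Real.exp_pos _).le]

theorem IsRegularExpFamily.integral_famMeasure (h : IsRegularExpFamily ν T)
    (θ : Fin p → ℝ) (g : Y → ℝ) :
    ∫ y, g y ∂(famMeasure ν T θ) = ∫ y, Real.exp (logLik ν T θ y) * g y ∂ν := by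
  have hm : Measurable fun y => ENNReal.ofReal (Real.exp (logLik ν T θ y)) :=
    (Real.measurable_exp.comp (measurable_logLik h.measurable_stat θ)).ennreal_ofReal
  rw [famMeasure, integral_withDensity_eq_integral_toReal_smul hm
    (ae_of_all _ fun y => ENNReal.ofReal_lt_top)]
  simp [ENNReal.toReal_ofReal, (Real.exp_pos _).le]

/-- Openness leaves room for `θ ± (r/2) e_j` in the natural parameter space, and the two
exponentials `exp (± r T_j / 2)` together dominate `|T_j|` up to the factor `2 / r`. -/
theorem IsRegularExpFamily.integrable_stat (h : IsRegularExpFamily ν T) {θ : Fin p → ℝ}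
    (hθ : θ ∈ naturalParams ν T) : Integrable T (famMeasure ν T θ) := by
  refine Integrable.of_eval fun j => ?_
  rw [h.integrable_famMeasure_iff]
  obtain ⟨r, hr, hball⟩ := Metric.isOpen_iff.1 h.isOpen_params θ hθ
  have hmem : ∀ s : ℝ, |s| < r → θ + Pi.single j s ∈ naturalParams ν T := fun s hs =>
    hball (by simpa [mem_ball_iff_norm, Pi.norm_single] using hs)
  have hr2 : |r / 2| < r := by rw [abs_of_pos (by positivity)]; linarith
  have h1 := hmem (r / 2) hr2
  have h2 := hmem (-(r / 2)) (by rwa [abs_neg])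
  have hj : Measurable fun y => T y j := (measurable_pi_apply j).comp h.measurable_stat
  refine Integrable.mono' (((h1.add h2).const_mul (2 / r)).const_mul
    (Real.exp (-logPartition ν T θ)))
    (((Real.measurable_exp.comp (measurable_logLik h.measurable_stat θ)).mul
      hj).aestronglyMeasurable) (ae_of_all _ fun y => ?_)
  have hb : |T y j| ≤ 2 / r * (Real.exp (r / 2 * T y j) + Real.exp (-(r / 2) * T y j)) := by
    have e1 := Real.add_one_le_exp (r / 2 * T y j)
    have e2 := Real.add_one_le_exp (-(r / 2) * T y j)
    have p1 := Real.exp_pos (r / 2 * T y j)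
    have p2 := Real.exp_pos (-(r / 2) * T y j)
    rw [div_mul_eq_mul_div, le_div_iff₀ hr]
    rcases abs_cases (T y j) with ⟨ha, _⟩ | ⟨ha, _⟩ <;> rw [ha] <;> linarith
  simp only [Pi.add_apply, add_dotProduct, single_dotProduct, Real.exp_add, norm_mul,
    Real.norm_eq_abs, Real.abs_exp, exp_logLik]
  calc _ ≤ Real.exp (θ ⬝ᵥ T y) * Real.exp (-logPartition ν T θ) *
      (2 / r * (Real.exp (r / 2 * T y j) + Real.exp (-(r / 2) * T y j))) := by gcongr
    _ = _ := by ring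

/-- Non-negativity of the Kullback–Leibler divergence within the family. -/
theorem IsRegularExpFamily.integral_logLik_famMeasure_le (h : IsRegularExpFamily ν T)
    {θ₀ θ : Fin p → ℝ} (hθ₀ : θ₀ ∈ naturalParams ν T) (hθ : θ ∈ naturalParams ν T) :
    ∫ y, logLik ν T θ y ∂(famMeasure ν T θ₀) ≤ ∫ y, logLik ν T θ₀ y ∂(famMeasure ν T θ₀) := by
  have := h.isProbabilityMeasure_famMeasure hθ₀
  have hi : ∀ θ', Integrable (logLik ν T θ') (famMeasure ν T θ₀) := fun θ' =>
    (integrable_dotProduct (h.integrable_stat hθ₀) θ').sub (integrable_const _)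
  have hd := ((h.integrable_famMeasure_iff θ₀ _).1 ((hi θ).sub (hi θ₀)))
  -- The tangent bound `1 + x ≤ exp x` at `x = ℓ_θ - ℓ_θ₀`, multiplied by the density `p_θ₀`.
  have hle := integral_mono ((integrable_exp_logLik hθ₀).add hd) (integrable_exp_logLik hθ)
    fun y => by
      have h1 := mul_le_mul_of_nonneg_left
        (Real.add_one_le_exp (logLik ν T θ y - logLik ν T θ₀ y))
        (Real.exp_pos (logLik ν T θ₀ y)).le
      rw [← Real.exp_add, add_sub_cancel] at h1
      simp only [Pi.add_apply, Pi.sub_apply]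
      linarith
  have hs := integral_add (integrable_exp_logLik hθ₀) hd
  simp only [Pi.add_apply] at hle
  rw [hs, integral_exp_logLik h.base_ne_zero hθ₀, integral_exp_logLik h.base_ne_zero hθ,
    ← h.integral_famMeasure, integral_sub' (hi θ) (hi θ₀)] at hle
  linarith

end ExpectedLogLik

/-! ### Separation of `θ₀` from distant parameters -/

section Separation

variable {Y : Type*} [MeasurableSpace Y] {p : ℕ} {ν : Measure Y} {T : Y → Fin p → ℝ}
  {𝓜 : Set (Set (Fin p → ℝ))} {S : ℕ → (Fin p → ℝ) → 𝓜} {M : 𝓜}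

/-- The norm on `Fin p → ℝ` is the sup norm, whence the factor `p`. -/
theorem abs_dotProduct_le (u v : Fin p → ℝ) : |u ⬝ᵥ v| ≤ p * (‖u‖ * ‖v‖) := by
  calc |u ⬝ᵥ v| ≤ ∑ i, |u i * v i| := Finset.abs_sum_le_sum_abs _ _
    _ ≤ ∑ _i : Fin p, ‖u‖ * ‖v‖ := Finset.sum_le_sum fun i _ => by
        rw [abs_mul]
        exact mul_le_mul (norm_le_pi_norm u i) (norm_le_pi_norm v i) (abs_nonneg _)
          (norm_nonneg _)
    _ = _ := by simp

/-- If `P_{n,θ}(M)⁻¹ = o(n)` uniformly, the normalized log-probability penalty vanishes. -/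
theorem InvSelProbSmallOn.eventually_log_le {V : Set (Fin p → ℝ)}
    (hV : InvSelProbSmallOn ν T S M V) {c : ℝ} (hc : 0 < c) :
    ∀ᶠ n : ℕ in atTop, ∀ θ ∈ V, modelSelProb ν T S M n θ ≠ 0 ∧
      (modelSelProb ν T S M n θ ≠ ⊤ →
        -((n : ℝ)⁻¹ * Real.log (modelSelProb ν T S M n θ).toReal) ≤ c) := by
  have hlog : Tendsto (fun n : ℕ => Real.log n / n) atTop (𝓝 0) := by
    have := (Real.tendsto_pow_log_div_mul_add_atTop 1 0 1 one_ne_zero).comp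
      tendsto_natCast_atTop_atTop
    simpa [Function.comp_def] using this
  -- Once the ratio is below `1`, every inverse probability is at most `n`, so the penalty is at
  -- most `log n / n`. The finiteness proviso is there because `V` need not lie in the parameter
  -- space and `toReal` sends `⊤` to `0`.
  filter_upwards [hV.eventually (gt_mem_nhds (zero_lt_one' ENNReal)),
    hlog.eventually (gt_mem_nhds hc), eventually_gt_atTop 0] with n h1 h2 hn θ hθ
  have hn0 : (n : ENNReal) ≠ 0 := Nat.cast_ne_zero.2 hn.ne'
  have hle : (modelSelProb ν T S M n θ)⁻¹ ≤ n := by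
    refine (le_iSup₂ (f := fun θ (_ : θ ∈ V) => (modelSelProb ν T S M n θ)⁻¹) θ hθ).trans ?_
    have := h1.le
    rwa [ENNReal.div_le_iff hn0 (ENNReal.natCast_ne_top n), one_mul] at this
  have hne : modelSelProb ν T S M n θ ≠ 0 := fun h0 => by
    rw [h0, ENNReal.inv_zero, top_le_iff] at hle
    exact ENNReal.natCast_ne_top n hle
  refine ⟨hne, fun htop => ?_⟩
  have hpos : 0 < (modelSelProb ν T S M n θ).toReal := ENNReal.toReal_pos hne htop
  have hinv : ((modelSelProb ν T S M n θ).toReal)⁻¹ ≤ n := by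
    have := ENNReal.toReal_mono (ENNReal.natCast_ne_top n) hle
    rwa [ENNReal.toReal_inv, ENNReal.toReal_natCast] at this
  have hl := Real.log_le_log (inv_pos.2 hpos) hinv
  rw [Real.log_inv] at hl
  have hmul := mul_le_mul_of_nonneg_left hl (inv_nonneg.2 (Nat.cast_nonneg (α := ℝ) n))
  rw [div_eq_inv_mul] at h2
  linarith

theorem IsRegularExpFamily.modelSelProb_le_one (h : IsRegularExpFamily ν T) {θ : Fin p → ℝ}
    (hθ : θ ∈ naturalParams ν T) (n : ℕ) : modelSelProb ν T S M n θ ≤ 1 := by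
  have := h.isProbabilityMeasure_famMeasure hθ
  exact prob_le_one

/-- When the mean statistic is close to its expectation `m`, the conditional likelihood at `θ₀`
beats the one at every parameter of the star-shaped set `K` that is far from `θ₀`. -/
theorem IsRegularExpFamily.eventually_condLogLik_lt (h : IsRegularExpFamily ν T)
    (hS : ∀ n N, MeasurableSet {t | S n t = N}) {K : Set (Fin p → ℝ)}
    (hK : K ⊆ naturalParams ν T) {θ₀ : Fin p → ℝ} (hθ₀ : θ₀ ∈ K) (hstar : StarConvex ℝ θ₀ K)
    {m : Fin p → ℝ} (hmax : IsMaxOn (fun θ => θ ⬝ᵥ m - logPartition ν T θ) K θ₀)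
    {r ε : ℝ} (hball : Metric.ball θ₀ r ⊆ naturalParams ν T)
    (hsmall : InvSelProbSmallOn ν T S M (Metric.ball θ₀ r ∩ K)) (hε : 0 < ε) (hεr : ε < r) :
    ∃ δ > 0, ∀ᶠ n : ℕ in atTop, n ≠ 0 ∧ modelSelProb ν T S M n θ₀ ≠ 0 ∧
      ∀ y : Fin n → Y, ‖meanStat T n y - m‖ ≤ δ → ∀ θ ∈ K, ε ≤ ‖θ - θ₀‖ →
        condLogLik ν T S M n y θ < condLogLik ν T S M n y θ₀ := by
  have hcvx := convex_naturalParams (μ := ν) h.measurable_stat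
  have hlin : ConcaveOn ℝ (naturalParams ν T) fun θ => θ ⬝ᵥ m :=
    ⟨hcvx, fun θ _ θ' _ a b _ _ _ => by simp [add_dotProduct, smul_dotProduct]⟩
  have hL : StrictConcaveOn ℝ (naturalParams ν T) fun θ => θ ⬝ᵥ m - logPartition ν T θ :=
    hlin.sub_strictConvexOn h.strictConvexOn_logPartition
  have hLc : ContinuousOn (fun θ => θ ⬝ᵥ m - logPartition ν T θ) (naturalParams ν T) :=
    (Continuous.continuousOn (by unfold dotProduct; fun_prop)).sub h.continuousOn_logPartition
  obtain ⟨η, hη, hgap⟩ := exists_gap_on_sphere h.isOpen_params hL hLc hK hθ₀ hstar hmax hε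
    ((Metric.closedBall_subset_ball hεr).trans hball)
  have hden : 0 < 3 * (p * ε + 1) := by positivity
  -- Chosen so that `p * ε * δ ≤ η / 3`; the `+ 1` keeps the denominator positive when `p = 0`.
  refine ⟨η / (3 * (p * ε + 1)), div_pos hη hden, ?_⟩
  filter_upwards [hsmall.eventually_log_le (div_pos hη three_pos), eventually_gt_atTop 0]
    with n hn hn0
  have hpos : modelSelProb ν T S M n θ₀ ≠ 0 :=
    (hn θ₀ ⟨Metric.mem_ball_self (hε.trans hεr), hθ₀⟩).1
  refine ⟨hn0.ne', hpos, fun y hy θ hθ hθε => ?_⟩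
  refine lt_of_concaveOn_of_sphere (h.concaveOn_condLogLik hS hn0.ne' (hK hθ₀) hpos y) hK hθ₀
    hstar hε (fun θ' hθ' hnorm => ?_) hθ hθε
  -- Of the gap `η`, one third pays for the penalty at `θ'` and one third for the deviation of the
  -- mean. The penalty at `θ₀` needs no lower bound on its probability here: `log P ≤ 0` only raises
  -- the value at `θ₀`.
  have hpen := (hn θ' ⟨by rwa [mem_ball_iff_norm, hnorm], hθ'⟩).2
    ((h.modelSelProb_le_one (hK hθ') n).trans_lt ENNReal.one_lt_top).ne
  have hpen₀ : (n : ℝ)⁻¹ * Real.log (modelSelProb ν T S M n θ₀).toReal ≤ 0 :=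
    mul_nonpos_of_nonneg_of_nonpos (by positivity) (Real.log_nonpos ENNReal.toReal_nonneg
      (ENNReal.toReal_le_of_le_ofReal zero_le_one
        (by simpa using h.modelSelProb_le_one (hK hθ₀) n)))
  have hdev : (θ' - θ₀) ⬝ᵥ (meanStat T n y - m) ≤ η / 3 := by
    calc (θ' - θ₀) ⬝ᵥ (meanStat T n y - m) ≤ p * (‖θ' - θ₀‖ * ‖meanStat T n y - m‖) :=
          (le_abs_self _).trans (abs_dotProduct_le _ _)
      _ ≤ p * (ε * (η / (3 * (p * ε + 1)))) := by rw [hnorm]; gcongr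
      _ = η / 3 * (p * ε / (p * ε + 1)) := by field_simp
      _ ≤ η / 3 * 1 := by
          gcongr
          exact (div_le_one (by positivity)).2 (by linarith)
      _ = η / 3 := mul_one _
  have hg := hgap θ' hθ' hnorm
  rw [condLogLik_eq_sub_log hn0.ne', condLogLik_eq_sub_log hn0.ne']
  simp only [sub_dotProduct, dotProduct_sub] at hdev
  linarith

/-- If all far parameters are worse than `θ₀`, a maximizer of the conditional likelihood over a
relatively closed parameter set exists. -/
theorem IsRegularExpFamily.exists_isCondMLE (h : IsRegularExpFamily ν T)
    (hS : ∀ n N, MeasurableSet {t | S n t = N}) {C : Set (Fin p → ℝ)} (hC : IsClosed C)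
    (hMC : M.1 = naturalParams ν T ∩ C) {θ₀ : Fin p → ℝ} (hθ₀ : θ₀ ∈ M.1) {ε : ℝ} (hε : 0 < ε)
    (hball : Metric.closedBall θ₀ ε ⊆ naturalParams ν T) {n : ℕ} (hn : n ≠ 0)
    (hpos : modelSelProb ν T S M n θ₀ ≠ 0) (y : Fin n → Y)
    (hfar : ∀ θ ∈ M.1, ε ≤ ‖θ - θ₀‖ → condLogLik ν T S M n y θ < condLogLik ν T S M n y θ₀) :
    ∃ θ, IsCondMLE ν T S M n y θ := by
  have hθΘ : θ₀ ∈ naturalParams ν T := hball (Metric.mem_closedBall_self hε.le)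
  have hsub : Metric.closedBall θ₀ ε ∩ C ⊆ M.1 := fun θ hθ => hMC ▸ ⟨hball hθ.1, hθ.2⟩
  obtain ⟨θ, hθ, hmax⟩ := ((isCompact_closedBall θ₀ ε).inter_right hC).exists_isMaxOn
    ⟨θ₀, Metric.mem_closedBall_self hε.le, (hMC ▸ hθ₀ : θ₀ ∈ naturalParams ν T ∩ C).2⟩
    ((h.continuousOn_condLogLik hS hn hθΘ hpos y).mono
      (inter_subset_left.trans hball))
  refine ⟨θ, hsub hθ, fun θ' hθ' => ?_⟩
  have hC' : θ' ∈ C := (hMC ▸ hθ' : θ' ∈ naturalParams ν T ∩ C).2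
  rcases le_total ε ‖θ' - θ₀‖ with hle | hle
  · exact (hfar θ' hθ' hle).le.trans (hmax ⟨Metric.mem_closedBall_self hε.le,
      (hMC ▸ hθ₀ : θ₀ ∈ naturalParams ν T ∩ C).2⟩)
  · exact hmax ⟨by rwa [mem_closedBall_iff_norm], hC'⟩

end Separation

/-! ### Concentration of the mean statistic, before and after conditioning -/

section Concentration

variable {Ω Y : Type*} [MeasurableSpace Ω] [MeasurableSpace Y] {p : ℕ} {T : Y → Fin p → ℝ}
  {P : Measure Ω} [IsProbabilityMeasure P] {f : Measure Y} [IsProbabilityMeasure f]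
  {y : ℕ → Ω → Y}

/-- Chebyshev's inequality for one coordinate of the mean statistic. -/
theorem measure_coord_deviation_le (hTm : Measurable T) (hy_meas : ∀ i, Measurable (y i))
    (hy_indep : iIndepFun y P) (hy_law : ∀ i, P.map (y i) = f) (hT : MemLp T 2 f)
    {δ : ℝ} (hδ : 0 < δ) {n : ℕ} (hn : n ≠ 0) (j : Fin p) :
    P {ω | δ ≤ |meanStat T n (fun i => y i ω) j - (∫ z, T z ∂f) j|} ≤
      ENNReal.ofReal (Var[fun z => T z j; f] / δ ^ 2) / n := by
  have hj : Measurable fun z => T z j := (measurable_pi_apply j).comp hTm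
  have hmp : ∀ i, MeasurePreserving (y i) P f := fun i => ⟨hy_meas i, hy_law i⟩
  have hX : ∀ i, MemLp (fun ω => T (y i ω) j) 2 P := fun i =>
    (hT.eval j).comp_measurePreserving (hmp i)
  have hindep : iIndepFun (fun i ω => T (y i ω) j) P := hy_indep.comp (fun _ z => T z j) fun _ => hj
  have hvar : ∀ i, Var[fun ω => T (y i ω) j; P] = Var[fun z => T z j; f] := fun i =>
    (hmp i).variance_fun_comp hj.aemeasurable
  have hexp : ∀ i, ∫ ω, T (y i ω) j ∂P = ∫ z, T z j ∂f := fun i => by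
    rw [← hy_law i, integral_map (hy_meas i).aemeasurable hj.aestronglyMeasurable]
  have hn' : (n : ℝ) ≠ 0 := Nat.cast_ne_zero.2 hn
  have hmean : ∀ ω, meanStat T n (fun i => y i ω) j =
      (n : ℝ)⁻¹ * ∑ i ∈ Finset.range n, T (y i ω) j := fun ω => by
    simp [meanStat, Finset.sum_apply, Finset.sum_range]
  have hsum : MemLp (fun ω => ∑ i ∈ Finset.range n, T (y i ω) j) 2 P :=
    memLp_finsetSum _ fun i _ => hX i
  have hE : ∫ ω, (n : ℝ)⁻¹ * ∑ i ∈ Finset.range n, T (y i ω) j ∂P = (∫ z, T z ∂f) j := by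
    rw [integral_const_mul, integral_finsetSum _ fun i _ => (hX i).integrable one_le_two,
      eval_integral fun i => (hT.eval i).integrable one_le_two]
    simp [hexp, hn']
  have hV : Var[fun ω => (n : ℝ)⁻¹ * ∑ i ∈ Finset.range n, T (y i ω) j; P] =
      Var[fun z => T z j; f] / n := by
    have hs := IndepFun.variance_sum (s := Finset.range n) (fun i _ => hX i)
      fun i _ k _ hik => hindep.indepFun hik
    rw [variance_const_mul]
    have hfun : (∑ i ∈ Finset.range n, fun ω => T (y i ω) j) =
        fun ω => ∑ i ∈ Finset.range n, T (y i ω) j := by ext ω; simp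
    rw [hfun] at hs
    rw [hs]
    simp only [hvar, Finset.sum_const, Finset.card_range, nsmul_eq_mul]
    field_simp
  have hch := meas_ge_le_variance_div_sq (hsum.const_mul (n : ℝ)⁻¹) hδ
  rw [hE, hV] at hch
  simp_rw [hmean]
  refine hch.trans_eq ?_
  rw [div_right_comm, ENNReal.ofReal_div_of_pos (Nat.cast_pos.2 hn.bot_lt), ENNReal.ofReal_natCast]

theorem exists_measure_deviation_le (hTm : Measurable T) (hy_meas : ∀ i, Measurable (y i))
    (hy_indep : iIndepFun y P) (hy_law : ∀ i, P.map (y i) = f) (hT : MemLp T 2 f)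
    {δ : ℝ} (hδ : 0 < δ) :
    ∃ c : ENNReal, c ≠ ⊤ ∧ ∀ n : ℕ, n ≠ 0 →
      P {ω | δ < ‖meanStat T n (fun i => y i ω) - ∫ z, T z ∂f‖} ≤ c / n := by
  refine ⟨∑ j, ENNReal.ofReal (Var[fun z => T z j; f] / δ ^ 2),
    ENNReal.sum_ne_top.2 fun _ _ => ENNReal.ofReal_ne_top, fun n hn => ?_⟩
  have hsub : {ω | δ < ‖meanStat T n (fun i => y i ω) - ∫ z, T z ∂f‖} ⊆
      ⋃ j ∈ (Finset.univ : Finset (Fin p)),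
        {ω | δ ≤ |meanStat T n (fun i => y i ω) j - (∫ z, T z ∂f) j|} := by
    intro ω hω
    by_contra hcon
    simp only [Finset.mem_univ, iUnion_true, mem_iUnion, mem_ofPred_eq, not_exists, not_le] at hcon
    exact not_le.2 hω ((pi_norm_le_iff_of_nonneg hδ.le).2 fun j => (hcon j).le)
  calc _ ≤ _ := measure_mono hsub
    _ ≤ _ := measure_biUnion_finset_le _ _
    _ ≤ ∑ j, ENNReal.ofReal (Var[fun z => T z j; f] / δ ^ 2) / n := Finset.sum_le_sum fun j _ =>
        measure_coord_deviation_le hTm hy_meas hy_indep hy_law hT hδ hn j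
    _ = _ := by simp_rw [div_eq_mul_inv]; rw [Finset.sum_mul]

/-- Conditioning on events whose inverse probability is `o(n)` preserves the concentration of the
mean statistic. -/
theorem tendsto_cond_deviation (hTm : Measurable T) (hy_meas : ∀ i, Measurable (y i))
    (hy_indep : iIndepFun y P) (hy_law : ∀ i, P.map (y i) = f) (hT : MemLp T 2 f)
    {E : ℕ → Set Ω} (hE : ∀ n, MeasurableSet (E n))
    (hsmall : Tendsto (fun n : ℕ => (P (E n))⁻¹ / (n : ENNReal)) atTop (𝓝 0))
    {δ : ℝ} (hδ : 0 < δ) :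
    Tendsto (fun n : ℕ => (P[|E n])
      {ω | δ < ‖meanStat T n (fun i => y i ω) - ∫ z, T z ∂f‖}) atTop (𝓝 0) := by
  obtain ⟨c, hc, hle⟩ := exists_measure_deviation_le hTm hy_meas hy_indep hy_law hT hδ
  have hlim : Tendsto (fun n : ℕ => c * ((P (E n))⁻¹ / (n : ENNReal))) atTop (𝓝 0) := by
    simpa using ENNReal.Tendsto.const_mul hsmall (Or.inr hc)
  refine tendsto_of_tendsto_of_tendsto_of_le_of_le' tendsto_const_nhds hlim
    (Eventually.of_forall fun _ => zero_le) ?_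
  filter_upwards [eventually_ne_atTop 0] with n hn
  rw [cond_apply (hE n)]
  calc _ ≤ (P (E n))⁻¹ * (c / n) := by
        gcongr
        exact (measure_mono inter_subset_right).trans (hle n hn)
    _ = _ := by rw [div_eq_mul_inv, div_eq_mul_inv]; ring

end Concentration

end SelectiveMLE

/-! ### Consistency and existence -/

open SelectiveMLE in
theorem mainTheorem3
    {Ω Y : Type*} [MeasurableSpace Ω] [MeasurableSpace Y] {p : ℕ}
    -- the base family
    (ν : Measure Y) (T : Y → Fin p → ℝ) (hfam : SelectiveMLE.IsRegularExpFamily ν T)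
    -- the countable collection of submodels, the selection procedure and the fixed model
    (𝓜 : Set (Set (Fin p → ℝ))) (h𝓜 : 𝓜.Countable)
    (hsub : ∀ N ∈ 𝓜, N ⊆ SelectiveMLE.naturalParams ν T)
    (S : ℕ → (Fin p → ℝ) → 𝓜) (hS : ∀ n N, MeasurableSet {t | S n t = N}) (M : 𝓜)
    -- the i.i.d. observations with true distribution `f`
    (P : Measure Ω) [IsProbabilityMeasure P] (f : Measure Y) [IsProbabilityMeasure f]
    (y : ℕ → Ω → Y) (hy_meas : ∀ i, Measurable (y i)) (hy_indep : iIndepFun y P)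
    (hy_law : ∀ i, P.map (y i) = f) (hT : MemLp T 2 f)
    -- the estimand
    (θ₀ : Fin p → ℝ) (hθ₀ : θ₀ ∈ M.1)
    (hθ₀_max : IsMaxOn (fun θ => ∫ z, SelectiveMLE.logLik ν T θ z ∂f) M.1 θ₀)
    -- `P_n(M)⁻¹ = o(n)`
    (htrue : Tendsto (fun n : ℕ => (P (SelectiveMLE.selEvent T S M y n))⁻¹ / (n : ENNReal))
      atTop (𝓝 0))
    -- `inf_θ P_{n,θ}(M) e^n → ∞`
    (hinf : Tendsto (fun n : ℕ => (⨅ θ ∈ M.1, SelectiveMLE.modelSelProb ν T S M n θ) *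
      ENNReal.ofReal (Real.exp n)) atTop (𝓝 ⊤))
    -- `sup_θ P_{n,θ}(M)⁻¹ = o(n)` near `θ₀`
    (hsup : ∃ r > 0, Metric.ball θ₀ r ⊆ SelectiveMLE.naturalParams ν T ∧
      ((StarConvex ℝ θ₀ M.1 ∧
          SelectiveMLE.InvSelProbSmallOn ν T S M (Metric.ball θ₀ r ∩ M.1)) ∨
        (∫ z, T z ∂f = ∫ z, T z ∂(SelectiveMLE.famMeasure ν T θ₀) ∧
          SelectiveMLE.InvSelProbSmallOn ν T S M (Metric.ball θ₀ r)))) :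
    -- post-selection consistency of the conditional MLE (the norm is the sup norm)
    (∀ θhat : ℕ → Ω → Fin p → ℝ,
      Tendsto (fun n : ℕ => (P[|SelectiveMLE.selEvent T S M y n])
        {ω | ¬ SelectiveMLE.IsCondMLE ν T S M n (fun i => y i ω) (θhat n ω)}) atTop (𝓝 0) →
      ∀ ε : ℝ, 0 < ε →
        Tendsto (fun n : ℕ => (P[|SelectiveMLE.selEvent T S M y n])
          {ω | ε < ‖θhat n ω - θ₀‖}) atTop (𝓝 0)) ∧
    -- existence of the conditional MLE
    ((∃ C : Set (Fin p → ℝ), IsClosed C ∧ M.1 = SelectiveMLE.naturalParams ν T ∩ C) →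
      Tendsto (fun n : ℕ => (P[|SelectiveMLE.selEvent T S M y n])
        {ω | ¬ ∃ θ, SelectiveMLE.IsCondMLE ν T S M n (fun i => y i ω) θ}) atTop (𝓝 0)) := by
  have hTi : Integrable T f := hT.integrable one_le_two
  have hmax : IsMaxOn (fun θ => θ ⬝ᵥ (∫ z, T z ∂f) - logPartition ν T θ) M.1 θ₀ := by
    simpa only [integral_logLik hTi] using hθ₀_max
  obtain ⟨r, hr, hball, hcase⟩ := hsup
  have hθΘ : θ₀ ∈ naturalParams ν T := hball (Metric.mem_ball_self hr)
  have hE : ∀ n, MeasurableSet (selEvent T S M y n) := fun n =>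
    measurable_pi_lambda (fun ω (i : Fin n) => y i ω) (fun i => hy_meas i)
      (measurableSet_selected hfam.measurable_stat hS n)
  -- Both cases reduce to a star-shaped `K ⊇ M.1` over which `θ₀` still maximizes the expected
  -- log-likelihood. In case (a) it is `M.1` itself. In case (b) it is the whole natural parameter
  -- space: matching means make the expected log-likelihood the one under `p_θ₀`, which `θ₀`
  -- maximizes globally because the Kullback–Leibler divergence is non-negative.
  obtain ⟨K, hMK, hKΘ, hstar, hmaxK, hsmall⟩ : ∃ K : Set (Fin p → ℝ), M.1 ⊆ K ∧
      K ⊆ naturalParams ν T ∧ StarConvex ℝ θ₀ K ∧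
      IsMaxOn (fun θ => θ ⬝ᵥ (∫ z, T z ∂f) - logPartition ν T θ) K θ₀ ∧
      InvSelProbSmallOn ν T S M (Metric.ball θ₀ r ∩ K) := by
    rcases hcase with ⟨hstar, hsmall⟩ | ⟨hmean, hsmall⟩
    · exact ⟨M.1, subset_rfl, hsub _ M.2, hstar, hmax, hsmall⟩
    · refine ⟨naturalParams ν T, hsub _ M.2, subset_rfl,
        (convex_naturalParams hfam.measurable_stat).starConvex hθΘ, fun θ hθ => ?_, ?_⟩
      · have := hfam.isProbabilityMeasure_famMeasure hθΘ
        have hle := hfam.integral_logLik_famMeasure_le hθΘ hθ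
        rw [integral_logLik (hfam.integrable_stat hθΘ),
          integral_logLik (hfam.integrable_stat hθΘ), ← hmean] at hle
        exact hle
      · rwa [inter_eq_left.2 hball]
  have hsep : ∀ ε, 0 < ε → ε < r → _ := fun ε hε hεr =>
    hfam.eventually_condLogLik_lt hS hKΘ (hMK hθ₀) hstar hmaxK hball hsmall hε hεr
  have hdev : ∀ δ : ℝ, 0 < δ → _ := fun δ hδ =>
    tendsto_cond_deviation hfam.measurable_stat hy_meas hy_indep hy_law hT hE htrue hδ
  refine ⟨fun θhat hθhat ε hε => ?_, fun ⟨C, hC, hMC⟩ => ?_⟩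
  -- The radius is capped by `r / 2` so that the sphere stays inside the ball where the penalty is
  -- controlled.
  · obtain ⟨δ, hδ, hev⟩ := hsep (min ε (r / 2)) (lt_min hε (half_pos hr))
      ((min_le_right _ _).trans_lt (half_lt_self hr))
    have hlim := hθhat.add (hdev δ hδ)
    rw [add_zero] at hlim
    refine tendsto_of_tendsto_of_tendsto_of_le_of_le' tendsto_const_nhds hlim
      (Eventually.of_forall fun _ => zero_le) ?_
    filter_upwards [hev] with n ⟨_, _, hn⟩
    -- For large `n`, an estimate far from `θ₀` either fails to be a conditional MLE or comes with a
    -- deviating mean: otherwise `θ₀ ∈ M.1` would have a strictly larger conditional likelihood.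
    refine (measure_mono fun ω hω => ?_).trans (measure_union_le _ _)
    by_contra hcon
    simp only [mem_union, mem_ofPred_eq, not_or, not_not, not_lt] at hcon
    exact not_le.2 (hn _ hcon.2 _ (hMK hcon.1.1) ((min_le_left _ _).trans (le_of_lt hω)))
      (hcon.1.2 hθ₀)
  · obtain ⟨δ, hδ, hev⟩ := hsep (r / 2) (half_pos hr) (half_lt_self hr)
    refine tendsto_of_tendsto_of_tendsto_of_le_of_le' tendsto_const_nhds (hdev δ hδ)
      (Eventually.of_forall fun _ => zero_le) ?_
    filter_upwards [hev] with n ⟨hn0, hpos, hn⟩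
    refine measure_mono fun ω hω => ?_
    by_contra hcon
    exact hω (hfam.exists_isCondMLE hS hC hMC hθ₀ (half_pos hr)
      ((Metric.closedBall_subset_ball (half_lt_self hr)).trans hball) hn0 hpos _
      fun θ hθ hle => hn _ (not_lt.1 hcon) θ (hMK hθ) hle)
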